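/- Let $\Bbbk$ be an algebraically closed field, $X$ a projective scheme over $\Bbbk$, and $L_1,L_2$ line bundles on $X$. Let $$S=\Bbbk\oplus\bigoplus_{(d,e)\in\mathbb N^2\setminus\{(0,0)\}}H^0(X,L_1^{\otimes d}\otimes L_2^{\otimes e})$$ be the double section ring, an $\mathbb N^2$-graded $\Bbbk$-algebra whose component in degree $(0,0)$ is $\Bbbk$, with multiplication of sections as product. Suppose that $(L_1,L_2)$ is doubly standard graded, that is, $L_1$ and $L_2$ are very ample and the algebra $S$ is generated by its components $S_{(1,0)}=H^0(X,L_1)$ and $S_{(0,1)}=H^0(X,L_2)$. Choosing bases of these two spaces, write $S$ as a quotient $\pi\colon \Bbbk[\alpha_0,\dots,\alpha_{N_1},\beta_0,\dots,\beta_{N_2}]\to S$ with $\deg\alpha_i=(1,0)$, $\deg\beta_j=(0,1)$. The polynomial ring acts on the divided power ring $\Bbbk_{dp}[x_0,\dots,x_{N_1},y_0,\dots,y_{N_2}]$ by contraction: $\alpha^{u}\beta^{v}\lrcorner\, x^{(a)}y^{(b)}$ is $x^{(a-u)}y^{(b-v)}$ if $u\le a$ and $v\le b$, and $0$ otherwise.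 The surjection $\pi$ in degree $(d,e)$ dualizes to an inclusion $H^0(X,L_1^{\otimes d}\otimes L_2^{\otimes e})^*\subset \Bbbk_{dp}[x,y]_{d,e}$; for a point $p=[F]\in\mathbb P(H^0(X,L_1^{\otimes d}\otimes L_2^{\otimes e})^*)$ let $\operatorname{Ann}(p)=\pi(\{\Theta\mid\Theta\lrcorner F=0\})$, an ideal of $S$. Let $d,e\ge 0$ with $(d,e)\ne(0,0)$, and let $p\in\mathbb P(H^0(X,L_1^{\otimes d}\otimes L_2^{\otimes e})^*)$. Then: 1. If $I\subset S$ is any bihomogeneous ideal, then $I\subset\operatorname{Ann}(p)$ if and only if $p\in\mathbb P(I_{d,e}^{\perp})$, where $I_{d,e}^{\perp}\subset H^0(X,L_1^{\otimes d}\otimes L_2^{\otimes e})^*$ is the space of functionals that vanish on $I_{d,e}$. 2. If $R\subset X$ is a closed subscheme and $J_R\subset S$ is the bihomogeneous ideal generated by all homogeneous elements of $S$ that vanish identically on $R$, then $J_R\subset\operatorname{Ann}(p)$ if and only if $p$ lies in the linear span of $R$ in $\mathbb P(H^0(X,L_1^{\otimes d}\otimes L_2^{\otimes e})^*)$, that is,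 in the smallest linear subspace that contains, scheme-theoretically, the image of $R$ under the embedding of $X$ given by the complete linear system of $L_1^{\otimes d}\otimes L_2^{\otimes e}$. -/

import Mathlib

open CategoryTheory AlgebraicGeometry TopologicalSpace Module
open scoped DirectSum

universe u

noncomputable section

namespace DoubleApolarity

/-! ### Projective space over a field, and morphisms to it in homogeneous coordinates -/

section ProjectiveSpace

attribute [local instance] MvPolynomial.gradedAlgebra

variable (σ : Type) (k : Type u) [Field k]

/-- The projective space `Proj k[X_i : i ∈ σ]`, with the standard grading of the polynomial ring. -/
abbrev ProjSpace : Scheme.{u} := Proj (MvPolynomial.homogeneousSubmodule σ k)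

/-- The structure morphism of projective space. -/
def ProjSpace.toSpec : ProjSpace σ k ⟶ Spec (.of k) :=
  Proj.toSpecZero (MvPolynomial.homogeneousSubmodule σ k) ≫
    Spec.map (CommRingCat.ofHom (algebraMap k (MvPolynomial.homogeneousSubmodule σ k 0)))

variable {σ k}

/-- The chart `D₊(X_j)`. -/
abbrev ProjSpace.chart (j : σ) : (ProjSpace σ k).Opens :=
  Proj.basicOpen (MvPolynomial.homogeneousSubmodule σ k) (MvPolynomial.X j)

/-- The regular function `ℓ / X_j` on `D₊(X_j)`, for a linear form `ℓ`. -/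
def ProjSpace.ratio (l : MvPolynomial.homogeneousSubmodule σ k 1) (j : σ) :
    Γ(ProjSpace σ k, ProjSpace.chart j) :=
  Proj.awayToSection (MvPolynomial.homogeneousSubmodule σ k) (MvPolynomial.X j)
    (HomogeneousLocalization.Away.mk (MvPolynomial.homogeneousSubmodule σ k)
      (f := MvPolynomial.X j) (d := 1) (MvPolynomial.isHomogeneous_X k j) 1 l.1
      l.2)

/-- The linear form `X_i`. -/
def coordForm (i : σ) : MvPolynomial.homogeneousSubmodule σ k 1 :=
  ⟨MvPolynomial.X i, MvPolynomial.isHomogeneous_X k i⟩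

/-- The linear form `∑ c_i X_i`. -/
def linForm [Fintype σ] (c : σ → k) : MvPolynomial.homogeneousSubmodule σ k 1 :=
  ∑ i, c i • coordForm i

/-- A morphism `f : T ⟶ ℙ` factors through the hyperplane `{ℓ = 0}` scheme-theoretically: on each
chart `D₊(X_j)` the pull-back to `T` of the equation `ℓ / X_j` of the hyperplane vanishes. -/
def FormVanishesOn {T : Scheme.{u}} (f : T ⟶ ProjSpace σ k)
    (l : MvPolynomial.homogeneousSubmodule σ k 1) : Prop :=
  ∀ j : σ, f.app (ProjSpace.chart j) (ProjSpace.ratio l j) = 0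

/-- On the open set `V`, the morphism `f` is given in homogeneous coordinates by the functions
`a i`: the open subset of `V` that is mapped to `D₊(X_j)` is the locus where `a j` is invertible,
and there the pull-back of `X_i / X_j` is `a i / a j`. -/
def HasHomogeneousCoords {X : Scheme.{u}} (f : X ⟶ ProjSpace σ k) (V : X.Opens)
    (a : σ → Γ(X, V)) : Prop :=
  ∀ j : σ, V ⊓ f ⁻¹ᵁ ProjSpace.chart j = X.basicOpen (a j) ∧
    ∀ (W : X.Opens) (hWV : W ≤ V) (hWf : W ≤ f ⁻¹ᵁ ProjSpace.chart j) (i : σ),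
      f.appLE (ProjSpace.chart j) W hWf (ProjSpace.ratio (coordForm i) j) *
        X.presheaf.map (homOfLE hWV).op (a j) = X.presheaf.map (homOfLE hWV).op (a i)

/-- `X` is projective over `k`. -/
def IsProjective {X : Scheme.{u}} (π : X ⟶ Spec (.of k)) : Prop :=
  ∃ (n : ℕ) (f : X ⟶ ProjSpace (Fin n) k), IsClosedImmersion f ∧ f ≫ ProjSpace.toSpec _ k = π

end ProjectiveSpace

/-! ### Line bundles -/

section LineBundle

variable {X : Scheme.{u}}

/-- Local frames (nowhere vanishing sections, trivializations `𝒪_V ≅ L|_V`) of `L` over `V`. -/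
def Frame (L : X.Modules) (V : X.Opens) : Type u :=
  {t : Γ(L, V) // ∀ (W : X.Opens) (h : W ≤ V),
    Function.Bijective fun a : Γ(X, W) => a • L.presheaf.map (homOfLE h).op t}

/-- `L` is a line bundle: it is locally isomorphic to the structure sheaf. -/
def IsLineBundle (L : X.Modules) : Prop :=
  ∀ x : X, ∃ V : X.Opens, x ∈ V ∧ Nonempty (Frame L V)

variable {k : Type u} [Field k] (π : X ⟶ Spec (.of k))

/-- The line bundle `L` is very ample over `k`: finitely many global sections of `L` are the
homogeneous coordinates of an immersion over `k` into a projective space. -/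
def IsVeryAmple (L : X.Modules) : Prop :=
  ∃ (n : ℕ) (s : Fin n → Γ(L, ⊤)) (f : X ⟶ ProjSpace (Fin n) k),
    IsImmersion f ∧ f ≫ ProjSpace.toSpec _ k = π ∧
    ∀ (V : X.Opens) (t : Frame L V) (a : Fin n → Γ(X, V)),
      (∀ i, L.presheaf.map (homOfLE le_top).op (s i) = a i • t.1) → HasHomogeneousCoords f V a

/-- The inclusion of constants `k → Γ(X, V)`. -/
def scalar (V : X.Opens) : k →+* Γ(X, V) :=
  ((Scheme.ΓSpecIso (.of k)).inv ≫ π.appTop ≫ X.presheaf.map (homOfLE le_top).op).hom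

lemma scalar_res {V W : X.Opens} (h : W ≤ V) (c : k) :
    X.presheaf.map (homOfLE h).op (scalar π V c) = scalar π W c := by
  simp only [scalar, CommRingCat.hom_comp, RingHom.comp_apply]
  rw [← CommRingCat.comp_apply, ← X.presheaf.map_comp]
  rfl

/-- Functions of an open set `V`, a frame of `L₁` over `V` and a frame of `L₂` over `V`, with values
in the regular functions on `V`. All operations are pointwise. -/
def FrameFun (_π : X ⟶ Spec (.of k)) (L₁ L₂ : X.Modules) : Type u :=
  ∀ V : X.Opens, Frame L₁ V → Frame L₂ V → Γ(X, V)

variable (L₁ L₂ : X.Modules)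

instance : CommRing (FrameFun π L₁ L₂) :=
  inferInstanceAs (CommRing (∀ V : X.Opens, Frame L₁ V → Frame L₂ V → Γ(X, V)))

instance : Algebra k (FrameFun π L₁ L₂) :=
  RingHom.toAlgebra
    (RingHom.pi fun V => RingHom.pi fun _ => RingHom.pi fun _ => scalar π V)

/-- `H⁰(X, L₁^d ⊗ L₂^e)` for line bundles `L₁`, `L₂` and `m = (d, e)`. A global section `s` is given
by its coefficients in all local frames: if `t₁`, `t₂` are frames of `L₁`, `L₂` over `V`, then
`s|_V = s(V, t₁, t₂) • t₁^d ⊗ t₂^e`. These coefficients are compatible with restriction, and if the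
frame `t₁` is `a • t₁'` and `t₂` is `b • t₂'`, then `s(V, t₁', t₂') = a^d b^e s(V, t₁, t₂)`.
Multiplication of sections `H⁰(L₁^d ⊗ L₂^e) × H⁰(L₁^d' ⊗ L₂^e') → H⁰(L₁^(d+d') ⊗ L₂^(e+e'))` is
multiplication of coefficients. -/
def H0 (m : ℕ × ℕ) : Submodule k (FrameFun π L₁ L₂) where
  carrier := {s | ∀ (V W : X.Opens) (h : W ≤ V) (t₁ : Frame L₁ V) (t₂ : Frame L₂ V)
    (t₁' : Frame L₁ W) (t₂' : Frame L₂ W) (a b : Γ(X, W)),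
    L₁.presheaf.map (homOfLE h).op t₁.1 = a • t₁'.1 →
    L₂.presheaf.map (homOfLE h).op t₂.1 = b • t₂'.1 →
    s W t₁' t₂' = a ^ m.1 * b ^ m.2 * X.presheaf.map (homOfLE h).op (s V t₁ t₂)}
  add_mem' := by
    intro s s' hs hs' V W h t₁ t₂ t₁' t₂' a b h₁ h₂
    change s W t₁' t₂' + s' W t₁' t₂' =
      _ * X.presheaf.map (homOfLE h).op (s V t₁ t₂ + s' V t₁ t₂)
    rw [hs V W h t₁ t₂ t₁' t₂' a b h₁ h₂, hs' V W h t₁ t₂ t₁' t₂' a b h₁ h₂, map_add, mul_add]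
  zero_mem' := by
    intro V W h t₁ t₂ t₁' t₂' a b _ _
    change (0 : Γ(X, W)) = _ * X.presheaf.map (homOfLE h).op (0 : Γ(X, V))
    rw [map_zero, mul_zero]
  smul_mem' := by
    intro c s hs V W h t₁ t₂ t₁' t₂' a b h₁ h₂
    have hsc : X.presheaf.map (homOfLE h).op (scalar π V c) = scalar π W c :=
      scalar_res π h c
    change scalar π W c * s W t₁' t₂' =
      _ * X.presheaf.map (homOfLE h).op (scalar π V c * s V t₁ t₂)
    rw [hs V W h t₁ t₂ t₁' t₂' a b h₁ h₂, map_mul, hsc]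
    ring

/-- The section `s` of `L₁^d ⊗ L₂^e` vanishes identically on the subscheme `ι : R ⟶ X`: its
restriction to `R` is zero, i.e. so are the restrictions of all its local coefficients. -/
def VanishesOn {π : X ⟶ Spec (.of k)} {L₁ L₂ : X.Modules} {R : Scheme.{u}} (ι : R ⟶ X)
    (s : FrameFun π L₁ L₂) : Prop :=
  ∀ (V : X.Opens) (t₁ : Frame L₁ V) (t₂ : Frame L₂ V), ι.app V (s V t₁ t₂) = 0

/-! ### The double section ring -/

/-- The component of the double section ring in degree `m`: the constants `k` for `m = (0, 0)`
and `H⁰(X, L₁^d ⊗ L₂^e)` for `m = (d, e) ≠ (0, 0)`. -/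
def piece (m : ℕ × ℕ) : Submodule k (FrameFun π L₁ L₂) :=
  if m = 0 then 1 else H0 π L₁ L₂ m

lemma one_le_H0 : (1 : Submodule k (FrameFun π L₁ L₂)) ≤ H0 π L₁ L₂ 0 := by
  intro s hs
  obtain ⟨c, rfl⟩ := Submodule.mem_one.mp hs
  intro V W h t₁ t₂ t₁' t₂' a b _ _
  change scalar π W c = a ^ 0 * b ^ 0 * X.presheaf.map (homOfLE h).op (scalar π V c)
  rw [pow_zero, pow_zero, one_mul, one_mul]
  exact (scalar_res π h _).symm

lemma piece_le (m : ℕ × ℕ) : piece π L₁ L₂ m ≤ H0 π L₁ L₂ m := by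
  unfold piece
  split_ifs with h
  · subst h
    exact one_le_H0 π L₁ L₂
  · exact le_rfl

lemma mul_mem_H0 {m n : ℕ × ℕ} {s s' : FrameFun π L₁ L₂} (hs : s ∈ H0 π L₁ L₂ m)
    (hs' : s' ∈ H0 π L₁ L₂ n) : s * s' ∈ H0 π L₁ L₂ (m + n) := by
  intro V W h t₁ t₂ t₁' t₂' a b h₁ h₂
  change s W t₁' t₂' * s' W t₁' t₂' =
    a ^ (m.1 + n.1) * b ^ (m.2 + n.2) * X.presheaf.map (homOfLE h).op (s V t₁ t₂ * s' V t₁ t₂)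
  rw [hs V W h t₁ t₂ t₁' t₂' a b h₁ h₂, hs' V W h t₁ t₂ t₁' t₂' a b h₁ h₂, map_mul]
  ring

instance : SetLike.GradedMonoid (piece π L₁ L₂) where
  one_mem := by
    rw [piece, if_pos rfl]
    exact Submodule.one_le.mp le_rfl
  mul_mem := by
    intro m n s s' hs hs'
    by_cases h : m + n = 0
    · have hm : m = 0 := by
        ext
        · have := congrArg Prod.fst h
          simp at this ⊢
          omega
        · have := congrArg Prod.snd h
          simp at this ⊢
          omega
      subst hm
      have hn : n = 0 := by simpa using h
      subst hn
      rw [piece, if_pos rfl] at hs hs'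
      rw [piece, if_pos h]
      simpa using Submodule.mul_mem_mul hs hs'
    · rw [piece, if_neg h]
      exact mul_mem_H0 π L₁ L₂ (piece_le _ _ _ _ hs) (piece_le _ _ _ _ hs')

/-- The double section ring `S = k ⊕ ⨁_{(d,e) ≠ (0,0)} H⁰(X, L₁^d ⊗ L₂^e)`. -/
abbrev DoubleSectionRing : Type u := ⨁ m : ℕ × ℕ, piece π L₁ L₂ m

variable {π L₁ L₂} in
/-- The homogeneous element of degree `m` of the double section ring given by `s`. -/
abbrev homog (m : ℕ × ℕ) (s : piece π L₁ L₂ m) : DoubleSectionRing π L₁ L₂ :=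
  DirectSum.lof k (ℕ × ℕ) (fun m => piece π L₁ L₂ m) m s

/-- `(L₁, L₂)` is doubly standard graded: both line bundles are very ample and the double section
ring is generated by its components of degrees `(1, 0)` and `(0, 1)`. -/
structure IsDoublyStandardGraded : Prop where
  veryAmple_left : IsVeryAmple π L₁
  veryAmple_right : IsVeryAmple π L₂
  generated : Algebra.adjoin k
    (Set.range (homog (π := π) (L₁ := L₁) (L₂ := L₂) (1, 0)) ∪
      Set.range (homog (π := π) (L₁ := L₁) (L₂ := L₂) (0, 1))) = ⊤

variable {π L₁ L₂}

/-- An ideal of the double section ring is bihomogeneous if it contains the homogeneous components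
of its elements. -/
def IsBihomogeneous (I : Ideal (DoubleSectionRing π L₁ L₂)) : Prop :=
  ∀ f ∈ I, ∀ m : ℕ × ℕ, homog m (f m) ∈ I

/-- The component `I_{d,e}`, as a subspace of `H⁰(X, L₁^d ⊗ L₂^e)`. -/
def idealPiece (I : Ideal (DoubleSectionRing π L₁ L₂)) (m : ℕ × ℕ) : Submodule k (H0 π L₁ L₂ m) :=
  ((I.restrictScalars k).comap (DirectSum.lof k (ℕ × ℕ) (fun m => piece π L₁ L₂ m) m)).map
    (Submodule.inclusion (piece_le π L₁ L₂ m))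

/-- The bihomogeneous ideal `J_R` of a subscheme `R` of `X`, generated by all the sections that
vanish identically on `R`. -/
def subschemeIdeal (π : X ⟶ Spec (.of k)) (L₁ L₂ : X.Modules) {R : Scheme.{u}} (ι : R ⟶ X) :
    Ideal (DoubleSectionRing π L₁ L₂) :=
  Ideal.span {f | ∃ (m : ℕ × ℕ) (s : piece π L₁ L₂ m), VanishesOn ι s.1 ∧ f = homog m s}

end LineBundle

/-! ### Apolarity in the polynomial ring -/

section Apolarity

variable {σ : Type} {k : Type u} [Field k]

variable (σ k) in
/-- The divided power ring `k_dp[x_i : i ∈ σ]` as a vector space: its basis consists of the divided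
power monomials `x^(v)`, with exponents `v : σ →₀ ℕ`. -/
abbrev DividedPowers : Type u := (σ →₀ ℕ) →₀ k

/-- The operator `α^u ⌟`: it sends `x^(v)` to `x^(v - u)` if `u ≤ v` and to `0` otherwise. In other
words, the coefficient of `α^u ⌟ F` at `x^(w)` is the coefficient of `F` at `x^(u + w)`. -/
def monomialContraction (u : σ →₀ ℕ) : End k (DividedPowers σ k) :=
  Finsupp.lcomapDomain (fun w => u + w) (add_right_injective u)

/-- The apolarity pairing `Θ ⌟ F`. -/
def contraction : MvPolynomial σ k →ₐ[k] End k (DividedPowers σ k) :=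
  AddMonoidAlgebra.lift k (End k (DividedPowers σ k)) (σ →₀ ℕ)
    { toFun := fun u => monomialContraction u.toAdd
      map_one' := by
        ext v w
        simp [monomialContraction]
      map_mul' := by
        intro u v
        refine LinearMap.ext fun F => Finsupp.ext fun w => ?_
        simp [monomialContraction, add_comm, add_left_comm] }

/-- The annihilator of `F` in the polynomial ring. -/
def polyAnn (F : DividedPowers σ k) : Ideal (MvPolynomial σ k) where
  carrier := {Θ | contraction Θ F = 0}
  add_mem' := by
    intro Θ Ψ hΘ hΨ
    simp_all
  zero_mem' := by simp
  smul_mem' := by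
    intro Θ Ψ hΨ
    simp_all

end Apolarity

/-! ### Apolarity in the double section ring, and linear spans -/

section DoubleSection

variable {X : Scheme.{u}} {k : Type u} [Field k] {π : X ⟶ Spec (.of k)} {L₁ L₂ : X.Modules}
  {n₁ n₂ : ℕ}

/-- A section of `L₁^d ⊗ L₂^e`, `(d, e) ≠ (0, 0)`, as a homogeneous element of the double section
ring. -/
def sectionElt {m : ℕ × ℕ} (hm : m ≠ 0) (s : H0 π L₁ L₂ m) : DoubleSectionRing π L₁ L₂ :=
  homog m ⟨s.1, by rw [piece, if_neg hm]; exact s.2⟩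

/-- The presentation `k[α_0, …, α_{N₁}, β_0, …, β_{N₂}] → S` of the double section ring, where the
variables `α_i` are mapped to a basis of `H⁰(X, L₁)` and `β_j` to a basis of `H⁰(X, L₂)`. -/
def presentation (α : Basis (Fin n₁) k (H0 π L₁ L₂ (1, 0)))
    (β : Basis (Fin n₂) k (H0 π L₁ L₂ (0, 1))) :
    MvPolynomial (Fin n₁ ⊕ Fin n₂) k →ₐ[k] DoubleSectionRing π L₁ L₂ :=
  MvPolynomial.aeval
    (Sum.elim (fun i => sectionElt (by simp) (α i)) (fun j => sectionElt (by simp) (β j)))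

/-- The inclusion `H⁰(X, L₁^d ⊗ L₂^e)^* ⊂ k_dp[x_0, …, x_{N₁}, y_0, …, y_{N₂}]_{d,e}`, dual to the
surjection `k[α, β]_{d,e} → H⁰(X, L₁^d ⊗ L₂^e)` with respect to the dual bases of monomials
`α^a β^b` and of divided power monomials `x^(a) y^(b)`. -/
def dualForm (α : Basis (Fin n₁) k (H0 π L₁ L₂ (1, 0)))
    (β : Basis (Fin n₂) k (H0 π L₁ L₂ (0, 1))) (m : ℕ × ℕ) (φ : Dual k (H0 π L₁ L₂ m)) :
    DividedPowers (Fin n₁ ⊕ Fin n₂) k :=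
  ∑ a ∈ Finset.finsuppAntidiag Finset.univ m.1, ∑ b ∈ Finset.finsuppAntidiag Finset.univ m.2,
    Finsupp.single (a.sumElim b)
      (φ (Submodule.inclusion (piece_le π L₁ L₂ m)
        (presentation α β (MvPolynomial.monomial (a.sumElim b) 1) m)))

/-- The ideal `Ann(p)` of the double section ring: the image, under the presentation of this ring,
of the annihilator in the polynomial ring of (any representative of) `p`. -/
def Ann (α : Basis (Fin n₁) k (H0 π L₁ L₂ (1, 0))) (β : Basis (Fin n₂) k (H0 π L₁ L₂ (0, 1)))
    {m : ℕ × ℕ} (p : Projectivization k (Dual k (H0 π L₁ L₂ m))) :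
    Ideal (DoubleSectionRing π L₁ L₂) :=
  (polyAnn (dualForm α β m p.rep)).map (presentation α β)

/-- The linear subspace `ℙ(W)` of `ℙ(E)`, for a subspace `W` of `E`. -/
def projSubspace {E : Type*} [AddCommGroup E] [Module k E] (W : Submodule k E) :
    Set (Projectivization k E) :=
  {p | p.submodule ≤ W}

/-- The morphism `f : X ⟶ ℙ(H⁰(X, L₁^d ⊗ L₂^e)^*)` over `k` is the one given by the complete linear
system of `L₁^d ⊗ L₂^e`, where the coordinates on the projective space are the basis `s` of
`H⁰(X, L₁^d ⊗ L₂^e)`. -/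
def IsCompleteLinearSystemMap {m : ℕ × ℕ} {n : ℕ} (s : Basis (Fin n) k (H0 π L₁ L₂ m))
    (f : X ⟶ ProjSpace (Fin n) k) : Prop :=
  f ≫ ProjSpace.toSpec _ k = π ∧
  ∀ (V : X.Opens) (t₁ : Frame L₁ V) (t₂ : Frame L₂ V),
    HasHomogeneousCoords f V (fun i => (s i).1 V t₁ t₂)

/-- A morphism `g : T ⟶ ℙ(E^*)`, where the coordinates on the projective space are the basis `s`
of `E`, factors scheme-theoretically through the linear subspace `ℙ(W)`, `W ⊂ E^*`: it factors
through all the hyperplanes that contain `ℙ(W)`. -/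
def MapsInto {E : Type*} [AddCommGroup E] [Module k E] {n : ℕ} (s : Basis (Fin n) k E)
    {T : Scheme.{u}} (g : T ⟶ ProjSpace (Fin n) k) (W : Submodule k (Dual k E)) : Prop :=
  ∀ c : Fin n → k, ∑ i, c i • s i ∈ W.dualCoannihilator → FormVanishesOn g (linForm c)

/-- The (projective) linear span of `g : T ⟶ ℙ(E^*)`, where the coordinates on the projective space
are the basis `s` of `E`: the smallest linear subspace `ℙ(W)` through which `g` factors
scheme-theoretically. -/
def linearSpan {E : Type*} [AddCommGroup E] [Module k E] {n : ℕ} (s : Basis (Fin n) k E)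
    {T : Scheme.{u}} (g : T ⟶ ProjSpace (Fin n) k) : Set (Projectivization k (Dual k E)) :=
  projSubspace (sInf {W : Submodule k (Dual k E) | MapsInto s g W})

end DoubleSection

end DoubleApolarity

end

/-!
Write `m = (d, e)` and let `φ` be a functional on `H⁰(X, L₁^d ⊗ L₂^e)` that represents `p`. Extended
by zero to the components of other degrees, `φ` becomes a functional `Φ = functional m φ` on the
double section ring `S`.

The divided power form `F` dual to `φ` has the coefficient `Φ(π(α^a β^b))` at `x^(a) y^(b)`, in all
degrees (`dualForm_apply`). So the coefficients of `Θ ⌟ F` are the values of `Φ` on the products of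
`π(Θ)` with the monomials. Since `π` is surjective, because `S` is generated by `S_(1,0)` and
`S_(0,1)`, this gives `Ann(p) = {f | Φ(f S) = 0}`: the apolar ideal is the largest ideal contained
in `ker Φ` (`mem_Ann`). A bihomogeneous ideal is contained in `ker Φ` if and only if its component of
degree `m` is contained in `ker φ`, which is the first equivalence (`le_Ann_iff`).

The second equivalence is the first one for `I = J_R`. On the one hand, the component of `J_R` of
degree `m` consists of all the sections that vanish on `R` (`idealPiece_subschemeIdeal`). On the
other hand, a hyperplane contains the image of `R` scheme-theoretically if and only if the
corresponding section vanishes on `R` (`formVanishesOn_iff`): on `D₊(X_j)`, where `L₁` and `L₂` are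
trivialized, the equation `ℓ / X_j` of the hyperplane and the section differ by a unit. By duality
for finite-dimensional spaces the linear span of `R` is then the linear subspace orthogonal to the
sections that vanish on `R` (`linearSpan_eq`).
-/

noncomputable section

namespace DoubleApolarity

/-! ### Apolarity in terms of a functional on the double section ring -/

section Functional

variable {X : Scheme.{u}} {k : Type u} [Field k] {π : X ⟶ Spec (.of k)} {L₁ L₂ : X.Modules}
  {n₁ n₂ : ℕ}

/-- A functional on `H⁰(X, L₁^d ⊗ L₂^e)`, `m = (d, e)`, as a functional on the double section ring:
it is zero on the components of degree other than `m`. -/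
def functional (m : ℕ × ℕ) (φ : Dual k (H0 π L₁ L₂ m)) : DoubleSectionRing π L₁ L₂ →ₗ[k] k :=
  φ ∘ₗ Submodule.inclusion (piece_le π L₁ L₂ m) ∘ₗ
    DirectSum.component k (ℕ × ℕ) (fun m => piece π L₁ L₂ m) m

lemma functional_apply {m : ℕ × ℕ} (φ : Dual k (H0 π L₁ L₂ m)) (f : DoubleSectionRing π L₁ L₂) :
    functional m φ f = φ (Submodule.inclusion (piece_le π L₁ L₂ m) (f m)) :=
  rfl

lemma homog_apply_self (m : ℕ × ℕ) (s : piece π L₁ L₂ m) : homog m s m = s :=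
  DirectSum.of_eq_same (β := fun m => piece π L₁ L₂ m) m s

lemma functional_homog_of_ne {m m' : ℕ × ℕ} (φ : Dual k (H0 π L₁ L₂ m)) (s : piece π L₁ L₂ m')
    (h : m' ≠ m) : functional m φ (homog m' s) = 0 := by
  have : homog m' s m = 0 := DirectSum.of_eq_of_ne (β := fun m => piece π L₁ L₂ m) m' m s h.symm
  rw [functional_apply, this, map_zero, map_zero]

/-- The bidegree of the monomial `α^a β^b`, where `w = (a, b)`. -/
def bidegree (w : Fin n₁ ⊕ Fin n₂ →₀ ℕ) : ℕ × ℕ :=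
  (∑ i, w (.inl i), ∑ j, w (.inr j))

lemma bidegree_add (v w : Fin n₁ ⊕ Fin n₂ →₀ ℕ) : bidegree (v + w) = bidegree v + bidegree w := by
  simp [bidegree, Finset.sum_add_distrib]

lemma homog_mul_homog {m m' : ℕ × ℕ} (s : piece π L₁ L₂ m) (s' : piece π L₁ L₂ m') :
    homog m s * homog m' s' = homog (m + m') ⟨s.1 * s'.1, SetLike.mul_mem_graded s.2 s'.2⟩ :=
  DirectSum.of_mul_of (A := fun m => piece π L₁ L₂ m) s s'

variable (α : Basis (Fin n₁) k (H0 π L₁ L₂ (1, 0))) (β : Basis (Fin n₂) k (H0 π L₁ L₂ (0, 1)))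

lemma presentation_X (i : Fin n₁ ⊕ Fin n₂) : ∃ s : piece π L₁ L₂ (bidegree (Finsupp.single i 1)),
    presentation α β (MvPolynomial.X i) = homog _ s := by
  rcases i with i | j
  · have h : bidegree (Finsupp.single (.inl i : Fin n₁ ⊕ Fin n₂) 1) = (1, 0) := by
      simp [bidegree, Finsupp.single_apply]
    rw [h]
    exact ⟨_, by rw [presentation, MvPolynomial.aeval_X]; rfl⟩
  · have h : bidegree (Finsupp.single (.inr j : Fin n₁ ⊕ Fin n₂) 1) = (0, 1) := by
      simp [bidegree, Finsupp.single_apply]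
    rw [h]
    exact ⟨_, by rw [presentation, MvPolynomial.aeval_X]; rfl⟩

/-- The presentation maps a monomial to a homogeneous element of the same bidegree. -/
lemma presentation_monomial (w : Fin n₁ ⊕ Fin n₂ →₀ ℕ) : ∃ s : piece π L₁ L₂ (bidegree w),
    presentation α β (MvPolynomial.monomial w 1) = homog (bidegree w) s := by
  have hadd : ∀ v w : Fin n₁ ⊕ Fin n₂ →₀ ℕ,
      (∃ s, presentation α β (MvPolynomial.monomial v 1) = homog (bidegree v) s) →
      (∃ s, presentation α β (MvPolynomial.monomial w 1) = homog (bidegree w) s) →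
      ∃ s, presentation α β (MvPolynomial.monomial (v + w) 1) = homog (bidegree (v + w)) s := by
    rintro v w ⟨s, hs⟩ ⟨s', hs'⟩
    have : MvPolynomial.monomial (v + w) (1 : k) =
        MvPolynomial.monomial v 1 * MvPolynomial.monomial w 1 := by
      rw [MvPolynomial.monomial_mul, one_mul]
    rw [this, map_mul, hs, hs', homog_mul_homog, bidegree_add]
    exact ⟨_, rfl⟩
  have hzero : ∃ s, presentation α β (MvPolynomial.monomial 0 1) =
      homog (bidegree (0 : Fin n₁ ⊕ Fin n₂ →₀ ℕ)) s := by
    have h : bidegree (0 : Fin n₁ ⊕ Fin n₂ →₀ ℕ) = 0 := by simp [bidegree]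
    have h1 : MvPolynomial.monomial (0 : Fin n₁ ⊕ Fin n₂ →₀ ℕ) (1 : k) = 1 := rfl
    rw [h, h1, map_one]
    exact ⟨⟨1, SetLike.GradedOne.one_mem⟩, rfl⟩
  refine Finsupp.induction_linear w hzero (fun v w => hadd v w) fun i n => ?_
  induction n with
  | zero => rw [Finsupp.single_zero]; exact hzero
  | succ n ih =>
    rw [Finsupp.single_add]
    exact hadd _ _ ih (presentation_X α β i)

/-- The dual form of `φ` is the generating function of the values of `φ` on the monomials. In
degrees other than `m` both sides are zero. -/
lemma dualForm_apply {m : ℕ × ℕ} (φ : Dual k (H0 π L₁ L₂ m)) (w : Fin n₁ ⊕ Fin n₂ →₀ ℕ) :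
    dualForm α β m φ w =
      functional m φ (presentation α β (MvPolynomial.monomial w 1)) := by
  obtain ⟨⟨a, b⟩, rfl⟩ := Finsupp.sumFinsuppEquivProdFinsupp.symm.surjective w
  simp only [Finsupp.sumFinsuppEquivProdFinsupp_symm_apply]
  have hinj : ∀ a' b', a'.sumElim b' = a.sumElim b ↔ a' = a ∧ b' = b := by
    intro a' b'
    have := Finsupp.sumFinsuppEquivProdFinsupp.symm.injective.eq_iff (a := (a', b')) (b := (a, b))
    simpa using this
  have hzero : bidegree (a.sumElim b) ≠ m →
      functional m φ (presentation α β (MvPolynomial.monomial (a.sumElim b) 1)) = 0 := by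
    intro h
    obtain ⟨s, hs⟩ := presentation_monomial α β (a.sumElim b)
    rw [hs]
    exact functional_homog_of_ne φ s h
  simp only [dualForm, Finsupp.finsetSum_apply, Finsupp.single_apply]
  rw [Finset.sum_eq_single a, Finset.sum_eq_single b, if_pos rfl]
  · rfl
  · intro b' _ hb'
    rw [if_neg fun h => hb' ((hinj _ _).mp h).2]
  · intro hb
    rw [if_pos rfl]
    refine hzero fun h => hb ?_
    simp [Finset.mem_finsuppAntidiag, ← h, bidegree]
  · intro a' _ ha'
    exact Finset.sum_eq_zero fun b' _ => if_neg fun h => ha' ((hinj _ _).mp h).1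
  · intro ha
    refine Finset.sum_eq_zero fun b' _ => ?_
    split_ifs with h
    · rw [h]
      refine hzero fun h => ha ?_
      simp [Finset.mem_finsuppAntidiag, ← h, bidegree]
    · rfl

lemma contraction_monomial (u w : Fin n₁ ⊕ Fin n₂ →₀ ℕ) (c : k)
    (F : DividedPowers (Fin n₁ ⊕ Fin n₂) k) :
    contraction (MvPolynomial.monomial u c) F w = c * F (u + w) := by
  have : contraction (MvPolynomial.monomial u c) = c • monomialContraction (k := k) u :=
    AddMonoidAlgebra.lift_single ..
  rw [this]
  rfl

/-- The coefficients of `Θ ⌟ F`, for the dual form `F` of `φ`, are the values of `φ` on the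
products of `π(Θ)` with the monomials. -/
lemma contraction_dualForm_apply {m : ℕ × ℕ} (φ : Dual k (H0 π L₁ L₂ m))
    (Θ : MvPolynomial (Fin n₁ ⊕ Fin n₂) k) (w : Fin n₁ ⊕ Fin n₂ →₀ ℕ) :
    contraction Θ (dualForm α β m φ) w =
      functional m φ (presentation α β (Θ * MvPolynomial.monomial w 1)) := by
  induction Θ using MvPolynomial.induction_on' with
  | monomial u c =>
    have : MvPolynomial.monomial u c * MvPolynomial.monomial w 1 =
        c • MvPolynomial.monomial (u + w) 1 := by
      rw [MvPolynomial.monomial_mul, MvPolynomial.smul_monomial, smul_eq_mul]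
    rw [contraction_monomial, dualForm_apply, this, map_smul, map_smul, smul_eq_mul]
  | add p q hp hq =>
    rw [map_add, add_mul, map_add, map_add, ← hp, ← hq]
    rfl

lemma mem_polyAnn_dualForm {m : ℕ × ℕ} (φ : Dual k (H0 π L₁ L₂ m))
    (Θ : MvPolynomial (Fin n₁ ⊕ Fin n₂) k) :
    Θ ∈ polyAnn (dualForm α β m φ) ↔
      ∀ Ψ, functional m φ (presentation α β Θ * presentation α β Ψ) = 0 := by
  change contraction Θ _ = 0 ↔ _
  simp_rw [← map_mul]
  constructor
  · intro h Ψ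
    induction Ψ using MvPolynomial.induction_on' with
    | monomial w c =>
      have : MvPolynomial.monomial w c = c • MvPolynomial.monomial w 1 := by
        rw [MvPolynomial.smul_monomial, smul_eq_mul, mul_one]
      rw [this, mul_smul_comm, map_smul, map_smul, ← contraction_dualForm_apply, h]
      simp
    | add p q hp hq => rw [mul_add, map_add, map_add, hp, hq, add_zero]
  · intro h
    ext w
    rw [contraction_dualForm_apply, h]
    rfl

/-- If the double section ring is generated in degrees `(1, 0)` and `(0, 1)`, its presentation is
surjective. -/
lemma presentation_surjective (hL : IsDoublyStandardGraded π L₁ L₂) :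
    Function.Surjective (presentation α β) := by
  rw [← AlgHom.range_eq_top, eq_top_iff, ← hL.generated, Algebra.adjoin_le_iff]
  have key : ∀ {m : ℕ × ℕ} (hm : m ≠ 0) {n : ℕ} (b : Basis (Fin n) k (H0 π L₁ L₂ m)),
      (∀ i, sectionElt hm (b i) ∈ (presentation α β).range) →
      ∀ s : piece π L₁ L₂ m, homog m s ∈ (presentation α β).range := by
    intro m hm n b hb s
    have h : piece π L₁ L₂ m = H0 π L₁ L₂ m := if_neg hm
    let g : H0 π L₁ L₂ m →ₗ[k] DoubleSectionRing π L₁ L₂ :=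
      DirectSum.lof k (ℕ × ℕ) (fun m => piece π L₁ L₂ m) m ∘ₗ Submodule.inclusion h.ge
    have hg : LinearMap.range g ≤ Subalgebra.toSubmodule (presentation α β).range := by
      rw [← Submodule.map_top, ← b.span_eq, Submodule.map_span_le]
      rintro _ ⟨i, rfl⟩
      exact hb i
    exact hg ⟨⟨s.1, h.le s.2⟩, rfl⟩
  rintro _ (⟨s, rfl⟩ | ⟨s, rfl⟩)
  · refine key (by simp) α (fun i => ⟨MvPolynomial.X (.inl i), ?_⟩) s
    exact MvPolynomial.aeval_X ..
  · refine key (by simp) β (fun j => ⟨MvPolynomial.X (.inr j), ?_⟩) s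
    exact MvPolynomial.aeval_X ..

/-- `Ann(p)` is the largest ideal in the kernel of the functional that represents `p`. -/
lemma mem_Ann (hL : IsDoublyStandardGraded π L₁ L₂) {m : ℕ × ℕ}
    (p : Projectivization k (Dual k (H0 π L₁ L₂ m))) (f : DoubleSectionRing π L₁ L₂) :
    f ∈ Ann α β p ↔ ∀ g, functional m p.rep (f * g) = 0 := by
  have hsurj := presentation_surjective α β hL
  rw [Ann, Ideal.mem_map_iff_of_surjective _ hsurj]
  constructor
  · rintro ⟨Θ, hΘ, rfl⟩ g
    obtain ⟨Ψ, rfl⟩ := hsurj g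
    exact (mem_polyAnn_dualForm α β _ Θ).mp hΘ Ψ
  · intro h
    obtain ⟨Θ, rfl⟩ := hsurj f
    exact ⟨Θ, (mem_polyAnn_dualForm α β _ Θ).mpr fun Ψ => h _, rfl⟩

lemma mem_projSubspace {E : Type*} [AddCommGroup E] [Module k E] (W : Submodule k E)
    (p : Projectivization k E) : p ∈ projSubspace W ↔ p.rep ∈ W := by
  change p.submodule ≤ W ↔ _
  rw [Projectivization.submodule_eq, Submodule.span_singleton_le_iff_mem]

/-- A bihomogeneous ideal is contained in `Ann(p)` if and only if `p` lies in the linear subspace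
orthogonal to its component in the degree of `p`. -/
lemma le_Ann_iff (hL : IsDoublyStandardGraded π L₁ L₂) {m : ℕ × ℕ}
    (p : Projectivization k (Dual k (H0 π L₁ L₂ m))) {I : Ideal (DoubleSectionRing π L₁ L₂)}
    (hI : IsBihomogeneous I) :
    I ≤ Ann α β p ↔ p ∈ projSubspace (idealPiece I m).dualAnnihilator := by
  rw [mem_projSubspace, Submodule.mem_dualAnnihilator]
  constructor
  · rintro h _ ⟨s, hs, rfl⟩
    have := (mem_Ann α β hL p _).mp (h hs) 1
    rwa [mul_one, functional_apply, homog_apply_self] at this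
  · intro h f hf
    rw [mem_Ann α β hL]
    exact fun g => h _ ⟨(f * g) m, hI _ (I.mul_mem_right g hf) m, rfl⟩

end Functional

/-! ### Hyperplanes in projective space -/

section Hyperplanes

attribute [local instance] MvPolynomial.gradedAlgebra

section

variable {A : Type u} [CommRing A] {τ : Type*} [SetLike τ A] [AddSubgroupClass τ A] (𝒜 : ℕ → τ)
  [GradedRing 𝒜]

/-- On `D₊(f)`, the pull-back of a function `c` of degree zero from `Spec 𝒜₀` is the fraction
`c / 1`. -/
lemma toSpecZero_appTop_res {f : A} {m : ℕ} (hf : f ∈ 𝒜 m) (hm : 0 < m) :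
    (Scheme.ΓSpecIso (.of (𝒜 0))).inv ≫ (Proj.toSpecZero 𝒜).appTop ≫
      (Proj 𝒜).presheaf.map (homOfLE le_top : Proj.basicOpen 𝒜 f ⟶ ⊤).op =
    CommRingCat.ofHom (HomogeneousLocalization.fromZeroRingHom 𝒜 (Submonoid.powers f)) ≫
      Proj.awayToSection 𝒜 f := by
  have h : (Proj.basicOpen 𝒜 f).ι ≫ Proj.toSpecZero 𝒜 = Proj.basicOpenToSpec 𝒜 f ≫
      Spec.map (CommRingCat.ofHom (HomogeneousLocalization.fromZeroRingHom 𝒜 _)) := by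
    have := Proj.awayι_toSpecZero 𝒜 f hf hm
    rw [Proj.awayι, Category.assoc, Iso.inv_comp_eq, Proj.basicOpenIsoSpec_hom] at this
    exact this
  have h2 := congr_arg (fun g => Scheme.Hom.appTop g) h
  simp only [Scheme.Hom.comp_appTop] at h2
  have h3 : (Proj.basicOpenToSpec 𝒜 f).appTop = _ := Proj.basicOpenToSpec_app_top 𝒜 f
  rw [h3, Scheme.Opens.ι_appTop, ← Category.assoc (Spec.map _).appTop, Scheme.ΓSpecIso_naturality,
    Category.assoc, ← Iso.inv_comp_eq] at h2
  have h4 := congr_arg (· ≫ (Proj.basicOpen 𝒜 f).topIso.hom) h2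
  simp only [Category.assoc, Iso.inv_hom_id, Category.comp_id] at h4
  have h5 : (Proj 𝒜).presheaf.map (homOfLE le_top : Proj.basicOpen 𝒜 f ⟶ ⊤).op =
      (Proj 𝒜).presheaf.map (homOfLE le_top : (Proj.basicOpen 𝒜 f).ι ''ᵁ ⊤ ⟶ ⊤).op ≫
        (Proj.basicOpen 𝒜 f).topIso.hom :=
    (Proj 𝒜).presheaf.map_comp _ _
  rw [h5]
  exact h4

end

variable {σ : Type} {k : Type u} [Field k]

/-- The function `ℓ / X_j` depends `k`-linearly on the linear form `ℓ`, where `k` acts through the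
structure morphism of projective space. -/
lemma ratio_linForm [Fintype σ] (c : σ → k) (j : σ) :
    ProjSpace.ratio (linForm c) j =
      ∑ i, scalar (ProjSpace.toSpec σ k) (ProjSpace.chart j) (c i) *
        ProjSpace.ratio (coordForm i) j := by
  have hsc : ∀ c : k, scalar (ProjSpace.toSpec σ k) (ProjSpace.chart j) c =
      Proj.awayToSection (MvPolynomial.homogeneousSubmodule σ k) (MvPolynomial.X j)
        (HomogeneousLocalization.fromZeroRingHom _ _
          (algebraMap k (MvPolynomial.homogeneousSubmodule σ k 0) c)) := by
    intro c
    have h := toSpecZero_appTop_res (MvPolynomial.homogeneousSubmodule σ k)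
      (MvPolynomial.isHomogeneous_X k j) one_pos
    have h2 := ConcreteCategory.congr_hom h
      (algebraMap k (MvPolynomial.homogeneousSubmodule σ k 0) c)
    refine Eq.trans ?_ h2
    rw [scalar, ProjSpace.toSpec, Scheme.Hom.comp_appTop, Category.assoc,
      ← Category.assoc _ (Spec.map _).appTop, ← Scheme.ΓSpecIso_inv_naturality, Category.assoc]
    rfl
  simp only [ProjSpace.ratio, hsc, ← map_mul, ← map_sum]
  congr 1
  apply HomogeneousLocalization.val_injective
  have hl : (linForm c).1 = ∑ i, MvPolynomial.C (c i) * MvPolynomial.X i := by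
    simp [linForm, coordForm, MvPolynomial.smul_eq_C_mul]
  refine (HomogeneousLocalization.Away.val_mk _ _ _ _ _).trans ?_
  let v := algebraMap (HomogeneousLocalization.Away (MvPolynomial.homogeneousSubmodule σ k)
    (MvPolynomial.X j)) (Localization.Away (MvPolynomial.X j : MvPolynomial σ k))
  refine Eq.trans ?_ (map_sum v _ _).symm
  rw [hl, Localization.mk_sum]
  refine Finset.sum_congr rfl fun i _ => Eq.trans ?_ (map_mul v _ _).symm
  -- The summand is the product of the fractions `c i / 1` and `X_i / X_j`.
  trans Localization.mk (MvPolynomial.C (c i)) 1 * Localization.mk (coordForm i).1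
    (⟨MvPolynomial.X j ^ 1, 1, rfl⟩ : Submonoid.powers (MvPolynomial.X j : MvPolynomial σ k))
  · rw [Localization.mk_mul, one_mul]
    rfl
  · rfl

lemma iSup_chart : ⨆ j : σ, ProjSpace.chart (k := k) j = ⊤ := by
  refine Proj.iSup_basicOpen_eq_top' _ _ (fun i => ⟨1, MvPolynomial.isHomogeneous_X k i⟩) ?_
  refine top_le_iff.mp fun p _ => ?_
  have : p ∈ Algebra.adjoin k (Set.range (MvPolynomial.X : σ → MvPolynomial σ k)) := by
    rw [MvPolynomial.adjoin_range_X]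
    trivial
  induction this using Algebra.adjoin_induction with
  | mem x hx => exact Algebra.subset_adjoin hx
  | algebraMap c =>
    exact Subalgebra.algebraMap_mem _ (algebraMap k (MvPolynomial.homogeneousSubmodule σ k 0) c)
  | add x y _ _ hx hy => exact add_mem (hx trivial) (hy trivial)
  | mul x y _ _ hx hy => exact mul_mem (hx trivial) (hy trivial)

end Hyperplanes

/-! ### Sections vanishing on a subscheme, and linear spans -/

section Span

variable {X : Scheme.{u}} {k : Type u} [Field k] {π : X ⟶ Spec (.of k)} {L₁ L₂ : X.Modules}
  {R : Scheme.{u}}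

lemma app_scalar {Y : Scheme.{u}} {f : X ⟶ Y} {ρ : Y ⟶ Spec (.of k)} (h : f ≫ ρ = π) (V : Y.Opens)
    (c : k) : f.app V (scalar ρ V c) = scalar π (f ⁻¹ᵁ V) c := by
  subst h
  simp only [scalar, Scheme.Hom.comp_appTop, Category.assoc]
  rw [← CommRingCat.comp_apply]
  simp only [Category.assoc, Scheme.Hom.naturality]
  rfl

lemma eq_zero_of_locally {V : X.Opens} (a : Γ(X, V))
    (h : ∀ x ∈ V, ∃ (W : X.Opens) (hW : W ≤ V), x ∈ W ∧ X.presheaf.map (homOfLE hW).op a = 0) :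
    a = 0 := by
  choose W hW hx h0 using h
  refine X.sheaf.eq_of_locally_eq' (fun x : V => W x.1 x.2) V (fun x => homOfLE (hW _ _)) ?_ a 0 ?_
  · exact fun x hx' => Opens.mem_iSup.mpr ⟨⟨x, hx'⟩, hx _ _⟩
  · intro x
    rw [map_zero]
    exact h0 _ _

lemma app_eq_zero_of_locally (ι : R ⟶ X) {V : X.Opens} (a : Γ(X, V))
    (h : ∀ x ∈ V, ∃ (W : X.Opens) (hW : W ≤ V), x ∈ W ∧
      ι.app W (X.presheaf.map (homOfLE hW).op a) = 0) :
    ι.app V a = 0 := by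
  refine eq_zero_of_locally _ fun x hx => ?_
  obtain ⟨W, hW, hxW, h0⟩ := h (ι x) hx
  refine ⟨ι ⁻¹ᵁ W, ι.preimage_mono hW, hxW, ?_⟩
  rw [← h0, ← CommRingCat.comp_apply, ← CommRingCat.comp_apply, Scheme.Hom.naturality]
  rfl

lemma isUnit_res_of_eq_basicOpen {V W : X.Opens} (a : Γ(X, V)) (h : W = X.basicOpen a)
    (hW : W ≤ V) : IsUnit (X.presheaf.map (homOfLE hW).op a) := by
  subst h
  exact RingedSpace.isUnit_res_basicOpen X.toRingedSpace a

/-- The restriction of a local frame to a smaller open set. -/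
def Frame.res {L : X.Modules} {V W : X.Opens} (t : Frame L V) (h : W ≤ V) : Frame L W :=
  ⟨L.presheaf.map (homOfLE h).op t.1, fun W' h' => by
    rw [← ConcreteCategory.comp_apply, ← Functor.map_comp]
    exact t.2 W' (h'.trans h)⟩

/-- On an open subset `W` of the preimage of `D₊(X_j)` where `L₁` and `L₂` are trivialized, the
coefficient of the section of `L₁^d ⊗ L₂^e` that corresponds to a linear form `ℓ` is the product of
the function `ℓ / X_j` and the coefficient of `s j`. -/
lemma section_eq_ratio_mul {m : ℕ × ℕ} {n : ℕ} {s : Basis (Fin n) k (H0 π L₁ L₂ m)}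
    {f : X ⟶ ProjSpace (Fin n) k} (hf : IsCompleteLinearSystemMap s f) (c : Fin n → k)
    {V W : X.Opens} (t₁ : Frame L₁ V) (t₂ : Frame L₂ V) (j : Fin n) (hW : W ≤ V)
    (hWf : W ≤ f ⁻¹ᵁ ProjSpace.chart j) :
    X.presheaf.map (homOfLE hW).op ((∑ i, c i • s i : H0 π L₁ L₂ m).1 V t₁ t₂) =
      f.appLE (ProjSpace.chart j) W hWf (ProjSpace.ratio (linForm c) j) *
        X.presheaf.map (homOfLE hW).op ((s j).1 V t₁ t₂) := by
  have h1 : (∑ i, c i • s i : H0 π L₁ L₂ m).1 V t₁ t₂ =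
      ∑ i, scalar π V (c i) * (s i).1 V t₁ t₂ := by
    let ev : FrameFun π L₁ L₂ →+ Γ(X, V) :=
      { toFun := fun s => s V t₁ t₂, map_zero' := rfl, map_add' := fun _ _ => rfl }
    rw [Submodule.coe_sum]
    exact map_sum ev (fun i => (c i • s i : H0 π L₁ L₂ m).1) Finset.univ
  have hsc : ∀ c, f.appLE (ProjSpace.chart j) W hWf
      (scalar (ProjSpace.toSpec (Fin n) k) (ProjSpace.chart j) c) = scalar π W c := by
    intro c
    rw [Scheme.Hom.appLE, CommRingCat.comp_apply, app_scalar hf.1]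
    exact scalar_res π hWf c
  rw [h1, ratio_linForm, map_sum, map_sum, Finset.sum_mul]
  refine Finset.sum_congr rfl fun i _ => ?_
  rw [map_mul, map_mul, hsc, scalar_res, mul_assoc, ((hf.2 V t₁ t₂) j).2 W hW hWf i]

/-- The hyperplane `∑ c_i X_i = 0` contains the image of `R` if and only if the section `∑ c_i s_i`
vanishes on `R`. -/
lemma formVanishesOn_iff (hL₁ : IsLineBundle L₁) (hL₂ : IsLineBundle L₂) {m : ℕ × ℕ} {n : ℕ}
    {s : Basis (Fin n) k (H0 π L₁ L₂ m)} {f : X ⟶ ProjSpace (Fin n) k}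
    (hf : IsCompleteLinearSystemMap s f) (ι : R ⟶ X) (c : Fin n → k) :
    FormVanishesOn (ι ≫ f) (linForm c) ↔
      VanishesOn ι (∑ i, c i • s i : H0 π L₁ L₂ m).1 := by
  constructor
  · intro h V t₁ t₂
    refine app_eq_zero_of_locally ι _ fun x hx => ?_
    have hx' : f x ∈ ⨆ j : Fin n, ProjSpace.chart (k := k) j := by rw [iSup_chart]; trivial
    obtain ⟨j, hj⟩ := Opens.mem_iSup.mp hx'
    refine ⟨V ⊓ f ⁻¹ᵁ ProjSpace.chart j, inf_le_left, ⟨hx, hj⟩, ?_⟩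
    have hj : ι.app _ (f.app _ (ProjSpace.ratio (linForm c) j)) = 0 := h j
    rw [section_eq_ratio_mul hf c t₁ t₂ j inf_le_left inf_le_right, map_mul]
    refine mul_eq_zero_of_left ?_ _
    rw [Scheme.Hom.appLE, CommRingCat.comp_apply, ← CommRingCat.comp_apply, Scheme.Hom.naturality,
      CommRingCat.comp_apply, hj, map_zero]
  · intro h j
    change ι.app _ (f.app _ (ProjSpace.ratio (linForm c) j)) = 0
    refine app_eq_zero_of_locally ι _ fun x hx => ?_
    obtain ⟨V₁, hx₁, ⟨t₁⟩⟩ := hL₁ x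
    obtain ⟨V₂, hx₂, ⟨t₂⟩⟩ := hL₂ x
    have t₁ := t₁.res (W := V₁ ⊓ V₂) inf_le_left
    have t₂ := t₂.res (W := V₁ ⊓ V₂) inf_le_right
    refine ⟨(V₁ ⊓ V₂) ⊓ f ⁻¹ᵁ ProjSpace.chart j, inf_le_right, ⟨⟨hx₁, hx₂⟩, hx⟩, ?_⟩
    -- This open set is the locus in `V₁ ⊓ V₂` where the coefficient of `s j` is invertible.
    have hunit : IsUnit (X.presheaf.map (homOfLE (inf_le_left :
        (V₁ ⊓ V₂) ⊓ f ⁻¹ᵁ ProjSpace.chart j ≤ V₁ ⊓ V₂)).op ((s j).1 (V₁ ⊓ V₂) t₁ t₂)) :=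
      isUnit_res_of_eq_basicOpen _ ((hf.2 _ t₁ t₂) j).1 _
    have key := congr_arg (ι.app _) (section_eq_ratio_mul hf c t₁ t₂ j
      (inf_le_left : (V₁ ⊓ V₂) ⊓ f ⁻¹ᵁ ProjSpace.chart j ≤ V₁ ⊓ V₂) inf_le_right)
    rw [map_mul] at key
    have h0 : ι.app ((V₁ ⊓ V₂) ⊓ f ⁻¹ᵁ ProjSpace.chart j) (X.presheaf.map (homOfLE inf_le_left).op
        ((∑ i, c i • s i : H0 π L₁ L₂ m).1 (V₁ ⊓ V₂) t₁ t₂)) = 0 := by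
      rw [← CommRingCat.comp_apply, Scheme.Hom.naturality, CommRingCat.comp_apply, h, map_zero]
    rw [h0] at key
    exact (hunit.map (ι.app _).hom).mul_left_eq_zero.mp key.symm

variable (π L₁ L₂) in
/-- The ideal of the elements of `FrameFun` that vanish identically on `R`. -/
def vanishingFrameFuns (ι : R ⟶ X) : Ideal (FrameFun π L₁ L₂) where
  carrier := {s | VanishesOn ι s}
  add_mem' := by
    intro s s' hs hs' V t₁ t₂
    change ι.app V (s V t₁ t₂ + s' V t₁ t₂) = 0
    rw [map_add, hs, hs', add_zero]
  zero_mem' := fun V _ _ => map_zero (ι.app V).hom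
  smul_mem' := by
    intro c s hs V t₁ t₂
    change ι.app V (c V t₁ t₂ * s V t₁ t₂) = 0
    rw [map_mul, hs, mul_zero]

variable (π L₁ L₂) in
/-- The sections of `L₁^d ⊗ L₂^e`, `m = (d, e)`, that vanish identically on `R`. -/
def vanishingSections (ι : R ⟶ X) (m : ℕ × ℕ) : Submodule k (H0 π L₁ L₂ m) :=
  ((vanishingFrameFuns π L₁ L₂ ι).restrictScalars k).comap (H0 π L₁ L₂ m).subtype

/-- The linear span of `R` is the linear subspace orthogonal to the sections that vanish on `R`. -/
lemma linearSpan_eq (hL₁ : IsLineBundle L₁) (hL₂ : IsLineBundle L₂) {m : ℕ × ℕ} {n : ℕ}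
    {s : Basis (Fin n) k (H0 π L₁ L₂ m)} {f : X ⟶ ProjSpace (Fin n) k}
    (hf : IsCompleteLinearSystemMap s f) (ι : R ⟶ X) :
    linearSpan s (ι ≫ f) = projSubspace (vanishingSections π L₁ L₂ ι m).dualAnnihilator := by
  have : FiniteDimensional k (H0 π L₁ L₂ m) := s.finiteDimensional_of_finite
  have hmaps : ∀ W : Submodule k (Dual k (H0 π L₁ L₂ m)), MapsInto s (ι ≫ f) W ↔
      W.dualCoannihilator ≤ vanishingSections π L₁ L₂ ι m := by
    intro W
    simp only [MapsInto, formVanishesOn_iff hL₁ hL₂ hf]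
    refine ⟨fun h t ht => ?_, fun h c hc => h hc⟩
    have := h (s.repr t)
    rw [s.sum_repr] at this
    exact this ht
  rw [linearSpan]
  -- Taking orthogonals turns the largest `W.dualCoannihilator` into the smallest `W`.
  congr 1
  refine le_antisymm (sInf_le ?_) (le_sInf fun W hW => ?_)
  · exact (hmaps _).mpr (Subspace.dualAnnihilator_dualCoannihilator_eq).le
  · rw [← Subspace.dualCoannihilator_dualAnnihilator_eq (W := W)]
    exact Submodule.dualAnnihilator_anti ((hmaps W).mp hW)

variable (π L₁ L₂) in
/-- The elements of the double section ring all of whose homogeneous components vanish on `R`. -/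
def vanishingIdeal (ι : R ⟶ X) : Ideal (DoubleSectionRing π L₁ L₂) where
  carrier := {f | ∀ m, (f m).1 ∈ vanishingFrameFuns π L₁ L₂ ι}
  add_mem' := fun hf hg m => add_mem (hf m) (hg m)
  zero_mem' := fun _ => zero_mem _
  smul_mem' := by
    classical
    intro g f hf m
    rw [smul_eq_mul, DirectSum.coe_mul_apply]
    exact sum_mem fun ij _ => Ideal.mul_mem_left _ _ (hf _)

lemma homog_mem_vanishingIdeal (ι : R ⟶ X) {m : ℕ × ℕ} {s : piece π L₁ L₂ m}
    (hs : VanishesOn ι s.1) : homog m s ∈ vanishingIdeal π L₁ L₂ ι := by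
  intro m'
  by_cases h : m' = m
  · subst h
    rw [homog_apply_self]
    exact hs
  · have : homog m s m' = 0 := DirectSum.of_eq_of_ne (β := fun m => piece π L₁ L₂ m) m m' s h
    rw [this]
    exact zero_mem _

/-- Products of the generators of `J_R` with arbitrary elements do not contribute new homogeneous
components: these vanish on `R` as well. -/
lemma subschemeIdeal_eq (ι : R ⟶ X) :
    subschemeIdeal π L₁ L₂ ι = vanishingIdeal π L₁ L₂ ι := by
  classical
  apply le_antisymm
  · refine Ideal.span_le.mpr ?_
    rintro _ ⟨m, s, hs, rfl⟩
    exact homog_mem_vanishingIdeal ι hs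
  · intro f hf
    rw [← DirectSum.sum_support_of f]
    exact sum_mem fun m _ => Ideal.subset_span ⟨m, f m, hf m, rfl⟩

lemma isBihomogeneous_subschemeIdeal (ι : R ⟶ X) :
    IsBihomogeneous (subschemeIdeal π L₁ L₂ ι) := by
  rw [subschemeIdeal_eq]
  exact fun f hf m => homog_mem_vanishingIdeal ι (hf m)

lemma idealPiece_subschemeIdeal (ι : R ⟶ X) {m : ℕ × ℕ} (hm : m ≠ 0) :
    idealPiece (subschemeIdeal π L₁ L₂ ι) m = vanishingSections π L₁ L₂ ι m := by
  rw [subschemeIdeal_eq]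
  ext s
  constructor
  · rintro ⟨s, hs, rfl⟩
    have := hs m
    rwa [homog_apply_self] at this
  · intro hs
    have h : piece π L₁ L₂ m = H0 π L₁ L₂ m := if_neg hm
    exact ⟨⟨s.1, h.ge s.2⟩, homog_mem_vanishingIdeal ι hs, rfl⟩

end Span

end DoubleApolarity

end

theorem proposition4p8 {k : Type u} [Field k] [IsAlgClosed k]
    {X : Scheme.{u}} (π : X ⟶ Spec (.of k)) (hX : DoubleApolarity.IsProjective π)
    (L₁ L₂ : X.Modules)
    (hL₁ : DoubleApolarity.IsLineBundle L₁) (hL₂ : DoubleApolarity.IsLineBundle L₂)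
    (hL : DoubleApolarity.IsDoublyStandardGraded π L₁ L₂)
    {n₁ n₂ : ℕ} (α : Basis (Fin n₁) k (DoubleApolarity.H0 π L₁ L₂ (1, 0)))
    (β : Basis (Fin n₂) k (DoubleApolarity.H0 π L₁ L₂ (0, 1)))
    (d e : ℕ) (hde : (d, e) ≠ (0, 0))
    (p : Projectivization k (Dual k (DoubleApolarity.H0 π L₁ L₂ (d, e)))) :
    (∀ I : Ideal (DoubleApolarity.DoubleSectionRing π L₁ L₂), DoubleApolarity.IsBihomogeneous I →
      (I ≤ DoubleApolarity.Ann α β p ↔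
        p ∈ DoubleApolarity.projSubspace
          (DoubleApolarity.idealPiece I (d, e)).dualAnnihilator)) ∧
    (∀ {R : Scheme.{u}} (ι : R ⟶ X) [IsClosedImmersion ι]
      {n : ℕ} (s : Basis (Fin n) k (DoubleApolarity.H0 π L₁ L₂ (d, e)))
      (f : X ⟶ DoubleApolarity.ProjSpace (Fin n) k),
      DoubleApolarity.IsCompleteLinearSystemMap s f →
      (DoubleApolarity.subschemeIdeal π L₁ L₂ ι ≤ DoubleApolarity.Ann α β p ↔
        p ∈ DoubleApolarity.linearSpan s (ι ≫ f))) := by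
  have hm : ((d, e) : ℕ × ℕ) ≠ 0 := hde
  refine ⟨fun I hI => DoubleApolarity.le_Ann_iff α β hL p hI, fun {R} ι _ {n} s f hf => ?_⟩
  rw [DoubleApolarity.le_Ann_iff α β hL p (DoubleApolarity.isBihomogeneous_subschemeIdeal ι),
    DoubleApolarity.idealPiece_subschemeIdeal ι hm, DoubleApolarity.linearSpan_eq hL₁ hL₂ hf]
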